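/- Let $(M,g)$ be a compact connected smooth Riemannian manifold (without boundary) of dimension $m+d$, let $H\subset TM$ be a smooth subbundle of rank $m$, and let $g_H=g|_H$, so that $(M,H,g_H)$ is a compact sub-Riemannian manifold; let $dv_g$ be the Riemannian volume element of $g$ and let $\pi_H:TM\to H$ be the $g$-orthogonal projection. For a smooth map $f:M\to N$ into a Riemannian manifold $(N,h)$ put $df_H=df\circ\pi_H$, so that $|df_H|^2=\sum_{i=1}^m|df(e_i)|^2$ for any $g$-orthonormal basis $e_1,\dots,e_m$ of $H_x$, and $E(f)=\int_M e^{|df_H|^2/2}\,dv_g$. The smooth map $f$ is called *exponentially subelliptic harmonic* if it is a critical point of $E$, i.e. $\frac{d}{dt}E(f_t)|_{t=0}=0$ for every smooth one-parameter family $\{f_t\}_{|t|<\epsilon}$ of maps $M\to N$ with $f_0=f$. For a smooth vector field $V$ along $f$ put $$I_H(V,V)=\int_M e^{\frac{|df_H|^2}{2}}\Big[\Big(\sum_{i}\langle\tilde\nabla_{e_i}V,df(e_i)\rangle\Big)^2+\sum_i\langle\tilde\nabla_{e_i}V,\tilde\nabla_{e_i}V\rangle-\sum_i\langle\tilde R(df(e_i),V)V,df(e_i)\rangle\Big]dv_g,$$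 where $\tilde\nabla$ is the pull-back to $f^{-1}TN$ of the Levi-Civita connection of $h$ and $\tilde R$ is the curvature tensor of $h$, with the sign convention $\tilde R(X,Y)Z=\tilde\nabla_X\tilde\nabla_YZ-\tilde\nabla_Y\tilde\nabla_XZ-\tilde\nabla_{[X,Y]}Z$. An exponentially subelliptic harmonic map $f$ is called *stable* if $I_H(V,V)\ge 0$ for every smooth vector field $V$ along $f$, and *unstable* otherwise. **Theorem.** Let $f:M\to S^n$ be a nonconstant exponentially subelliptic harmonic map from such a compact sub-Riemannian manifold into the unit sphere $S^n\subset\mathbb{R}^{n+1}$ with its induced metric. If $$\int_M e^{\frac{|df_H|^2}{2}}\,|df_H|^2\big(|df_H|^2-(n-2)\big)\,dv_g<0,$$ then $f$ is unstable. -/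

import Mathlib

open scoped Manifold ContDiff
open MeasureTheory

noncomputable section

namespace ExpSubelliptic

/-- The Euclidean space `ℝᵏ`. -/
abbrev Euc (k : ℕ) : Type := EuclideanSpace ℝ (Fin k)

/-- The standard basis vector `∂ᵢ` of `ℝᵏ`. -/
abbrev stdVec {k : ℕ} (i : Fin k) : Euc k := EuclideanSpace.single i 1

/-- Smooth Riemannian metrics on a `k`-dimensional manifold `X` without boundary. -/
abbrev RMetric (k : ℕ) (X : Type*) [TopologicalSpace X] [ChartedSpace (Euc k) X]
    [IsManifold (𝓡 k) ∞ X] : Type _ :=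
  Bundle.ContMDiffRiemannianMetric (𝓡 k) ∞ (Euc k) (fun x : X => TangentSpace (𝓡 k) x)

/-! ### Riemannian geometry in the charts `extChartAt (𝓡 k) p` -/

section Charts

variable {k : ℕ} {X : Type*} [TopologicalSpace X] [ChartedSpace (Euc k) X]
  [IsManifold (𝓡 k) ∞ X]

/-- The differential at `q` of the chart at `p`. -/
def dChart (p q : X) (v : TangentSpace (𝓡 k) q) : Euc k :=
  mfderiv (𝓡 k) (𝓡 k) (extChartAt (𝓡 k) p) q v

/-- The differential at `y` of the inverse of the chart at `p`. -/
def dChartSymm (p : X) (y a : Euc k) : TangentSpace (𝓡 k) ((extChartAt (𝓡 k) p).symm y) :=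
  mfderiv (𝓡 k) (𝓡 k) (extChartAt (𝓡 k) p).symm y a

/-- The tangent vector at `p` with the components `a` in the chart at `p`. -/
def ofChart (p : X) (a : Euc k) : TangentSpace (𝓡 k) p :=
  mfderiv (𝓡 k) (𝓡 k) (extChartAt (𝓡 k) p).symm (extChartAt (𝓡 k) p p) a

/-- The metric read in the chart at `p`: the value at the point `y` of the chart domain in `ℝᵏ`
on the vectors `a`, `b` of `ℝᵏ`. -/
def chartMetric (h : RMetric k X) (p : X) (y a b : Euc k) : ℝ :=
  h.inner ((extChartAt (𝓡 k) p).symm y) (dChartSymm p y a) (dChartSymm p y b)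

/-- The matrix `(h_{ij})` of the metric in the chart at `p`. -/
def gram (h : RMetric k X) (p : X) (y : Euc k) : Matrix (Fin k) (Fin k) ℝ :=
  Matrix.of fun i j => chartMetric h p y (stdVec i) (stdVec j)

/-- The Christoffel symbols of the Levi-Civita connection in the chart at `p`, as a bilinear
expression: `Γ(a, b)ʳ = ½ ∑ₗ h^{rl} (∂ₐ h(b, ∂ₗ) + ∂_b h(a, ∂ₗ) - ∂ₗ h(a, b))`. -/
def christoffel (h : RMetric k X) (p : X) (y a b : Euc k) : Euc k :=
  WithLp.toLp 2 fun r => (1 / 2 : ℝ) * ∑ l : Fin k, (gram h p y)⁻¹ r l *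
    (fderiv ℝ (fun z => chartMetric h p z b (stdVec l)) y a
      + fderiv ℝ (fun z => chartMetric h p z a (stdVec l)) y b
      - fderiv ℝ (fun z => chartMetric h p z a b) y (stdVec l))

/-- The curvature tensor `R(a, b) c` in the chart at `p`, with
`R(X, Y) Z = ∇_X ∇_Y Z - ∇_Y ∇_X Z - ∇_[X, Y] Z`. -/
def chartCurvature (h : RMetric k X) (p : X) (y a b c : Euc k) : Euc k :=
  fderiv ℝ (fun z => christoffel h p z b c) y a - fderiv ℝ (fun z => christoffel h p z a c) y b
    + christoffel h p y a (christoffel h p y b c) - christoffel h p y b (christoffel h p y a c)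

/-- The Riemann curvature tensor `R(u, v) w` of the Levi-Civita connection of `h` at `p`. -/
def curvature (h : RMetric k X) (p : X) (u v w : TangentSpace (𝓡 k) p) :
    TangentSpace (𝓡 k) p :=
  ofChart p (chartCurvature h p (extChartAt (𝓡 k) p p)
    (dChart p p u) (dChart p p v) (dChart p p w))

/-- A smooth partition of unity on `X`, indexed by the points of `X`, the function with index `i`
being supported in the domain of the chart at `i`. -/
def chartPartition (k : ℕ) (X : Type*) [TopologicalSpace X] [ChartedSpace (Euc k) X]
    [IsManifold (𝓡 k) ∞ X] [T2Space X] [SigmaCompactSpace X] :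
    SmoothPartitionOfUnity X (𝓡 k) X Set.univ :=
  (SmoothPartitionOfUnity.exists_isSubordinate_chartAt_source (𝓡 k) X).choose

/-- The Riemannian volume measure `dv_g`: in the chart at `i` it is `√(det g) dy`, and these
local measures are glued by a partition of unity. -/
def riemannianVolume [T2Space X] [SigmaCompactSpace X] [MeasurableSpace X] (g : RMetric k X) :
    Measure X :=
  Measure.sum fun i : X =>
    (((volume.restrict (extChartAt (𝓡 k) i).target).withDensity
        fun y => ENNReal.ofReal (√(gram g i y).det)).map
      (extChartAt (𝓡 k) i).symm).withDensity
        fun x => ENNReal.ofReal (chartPartition k X i x)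

end Charts

/-! ### Sub-Riemannian manifolds -/

/-- A sub-Riemannian structure on an `(m + d)`-dimensional manifold: a Riemannian metric `g` and a
smooth subbundle `H` of rank `m` of the tangent bundle. -/
structure SubRiemannianStructure (m d : ℕ) (M : Type*) [TopologicalSpace M]
    [ChartedSpace (Euc (m + d)) M] [IsManifold (𝓡 (m + d)) ∞ M] where
  /-- The Riemannian metric. -/
  g : RMetric (m + d) M
  /-- The horizontal distribution. -/
  H : ∀ x : M, Submodule ℝ (TangentSpace (𝓡 (m + d)) x)
  /-- `H` is locally spanned by `m` smooth, pointwise linearly independent vector fields. -/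
  exists_localFrame : ∀ x₀ : M, ∃ U : Set M, IsOpen U ∧ x₀ ∈ U ∧
    ∃ s : Fin m → ∀ x : M, TangentSpace (𝓡 (m + d)) x,
      (∀ i, ContMDiffOn (𝓡 (m + d)) (𝓡 (m + d)).tangent ∞
        (fun x => (⟨x, s i x⟩ : TangentBundle (𝓡 (m + d)) M)) U) ∧
      ∀ x ∈ U, LinearIndependent ℝ (fun i => s i x) ∧
        Submodule.span ℝ (Set.range fun i => s i x) = H x

section SubRiemannian

variable {m d : ℕ} {M : Type*} [TopologicalSpace M] [ChartedSpace (Euc (m + d)) M]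
  [IsManifold (𝓡 (m + d)) ∞ M]

theorem SubRiemannianStructure.exists_orthonormal (S : SubRiemannianStructure m d M) (x : M) :
    ∃ e : Fin m → TangentSpace (𝓡 (m + d)) x,
      (∀ i, e i ∈ S.H x) ∧ ∀ i j, S.g.inner x (e i) (e j) = if i = j then 1 else 0 := by
  obtain ⟨U, -, hx, s, -, hs⟩ := S.exists_localFrame x
  obtain ⟨hli, hsp⟩ := hs x hx
  have hrank : Module.finrank ℝ (S.H x) = m := by
    rw [← hsp, finrank_span_eq_card hli, Fintype.card_fin]
  let c := S.g.toRiemannianMetric.toCore x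
  let _ : NormedAddCommGroup (TangentSpace (𝓡 (m + d)) x) := c.toNormedAddCommGroup
  let _ : InnerProductSpace ℝ (TangentSpace (𝓡 (m + d)) x) := InnerProductSpace.ofCore c.toCore
  have : FiniteDimensional ℝ (TangentSpace (𝓡 (m + d)) x) :=
    inferInstanceAs (FiniteDimensional ℝ (Euc (m + d)))
  let b := (stdOrthonormalBasis ℝ (S.H x)).reindex (finCongr hrank)
  refine ⟨fun i => (b i : TangentSpace (𝓡 (m + d)) x), fun i => (b i).2, fun i j => ?_⟩
  exact (orthonormal_iff_ite.mp b.orthonormal) i j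

/-- A `g`-orthonormal basis `e₁, …, e_m` of the horizontal space `H_x`. -/
def SubRiemannianStructure.frame (S : SubRiemannianStructure m d M) (x : M) (i : Fin m) :
    TangentSpace (𝓡 (m + d)) x :=
  (S.exists_orthonormal x).choose i

/-! ### The exponential energy, its critical maps, and stability -/

variable {n : ℕ} {N : Type*} [TopologicalSpace N] [ChartedSpace (Euc n) N]
  [IsManifold (𝓡 n) ∞ N]

/-- `|df_H|²`, where `df_H = df ∘ π_H`: the sum of `h(df(eᵢ), df(eᵢ))` over an orthonormal basis of
the horizontal space (`df_H` vanishes on the orthogonal complement of `H`). -/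
def normSqHoriz (S : SubRiemannianStructure m d M) (h : RMetric n N) (f : M → N) (x : M) : ℝ :=
  ∑ i : Fin m, h.inner (f x) (mfderiv (𝓡 (m + d)) (𝓡 n) f x (S.frame x i))
    (mfderiv (𝓡 (m + d)) (𝓡 n) f x (S.frame x i))

/-- The horizontal exponential energy `E(f) = ∫ exp(|df_H|² / 2) dv_g`. -/
def energy [T2Space M] [SigmaCompactSpace M] [MeasurableSpace M]
    (S : SubRiemannianStructure m d M) (h : RMetric n N) (f : M → N) : ℝ :=
  ∫ x, Real.exp (normSqHoriz S h f x / 2) ∂(riemannianVolume S.g)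

/-- Exponentially subelliptic harmonic maps (on a compact `M`): smooth maps that are critical for
the energy with respect to all smooth one-parameter variations `F t`, `|t| < ε`. -/
def IsExpSubellipticHarmonic [T2Space M] [SigmaCompactSpace M] [MeasurableSpace M]
    (S : SubRiemannianStructure m d M) (h : RMetric n N) (f : M → N) : Prop :=
  ContMDiff (𝓡 (m + d)) (𝓡 n) ∞ f ∧
    ∀ ε : ℝ, 0 < ε → ∀ F : ℝ → M → N,
      ContMDiffOn ((𝓘(ℝ, ℝ)).prod (𝓡 (m + d))) (𝓡 n) ∞ (fun q : ℝ × M => F q.1 q.2)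
        (Set.Ioo (-ε) ε ×ˢ Set.univ) →
      F 0 = f → HasDerivAt (fun t => energy S h (F t)) 0 0

/-- The derivative at `x` in the direction `u` of the components of a vector field `V` along `f`,
taken in the chart of `N` at `f x`. -/
def dCoord (f : M → N) (V : ∀ x : M, TangentSpace (𝓡 n) (f x)) (x : M)
    (u : TangentSpace (𝓡 (m + d)) x) : Euc n :=
  mfderiv (𝓡 (m + d)) (𝓡 n) (fun z : M => dChart (f x) (f z) (V z)) x u

/-- The pull-back to `f⁻¹TN` of the Levi-Civita connection of `h`: the covariant derivative at `x`
in the direction `u` of a vector field `V` along `f`. In the chart `φ` of `N` at `f x` it is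
`d(dφ(V))(u) + Γ(dφ(df(u)), dφ(V))`. -/
def pullbackCov (h : RMetric n N) (f : M → N) (V : ∀ x : M, TangentSpace (𝓡 n) (f x)) (x : M)
    (u : TangentSpace (𝓡 (m + d)) x) : TangentSpace (𝓡 n) (f x) :=
  ofChart (f x)
    (dCoord f V x u
      + christoffel h (f x) (extChartAt (𝓡 n) (f x) (f x))
        (dChart (f x) (f x) (mfderiv (𝓡 (m + d)) (𝓡 n) f x u))
        (dChart (f x) (f x) (V x)))

/-- The index form `I_H(V, V)` of `f` on a vector field `V` along `f`. -/
def indexForm [T2Space M] [SigmaCompactSpace M] [MeasurableSpace M]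
    (S : SubRiemannianStructure m d M) (h : RMetric n N) (f : M → N)
    (V : ∀ x : M, TangentSpace (𝓡 n) (f x)) : ℝ :=
  ∫ x, Real.exp (normSqHoriz S h f x / 2) *
    ((∑ i : Fin m, h.inner (f x) (pullbackCov h f V x (S.frame x i))
        (mfderiv (𝓡 (m + d)) (𝓡 n) f x (S.frame x i))) ^ 2
      + ∑ i : Fin m, h.inner (f x) (pullbackCov h f V x (S.frame x i))
        (pullbackCov h f V x (S.frame x i))
      - ∑ i : Fin m, h.inner (f x)
        (curvature h (f x) (mfderiv (𝓡 (m + d)) (𝓡 n) f x (S.frame x i)) (V x) (V x))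
        (mfderiv (𝓡 (m + d)) (𝓡 n) f x (S.frame x i))) ∂(riemannianVolume S.g)

/-- Stability (on a compact `M`, where all vector fields have compact support): `I_H(V, V) ≥ 0` for
every smooth vector field `V` along `f`. -/
def IsStable [T2Space M] [SigmaCompactSpace M] [MeasurableSpace M]
    (S : SubRiemannianStructure m d M) (h : RMetric n N) (f : M → N) : Prop :=
  ∀ V : ∀ x : M, TangentSpace (𝓡 n) (f x),
    ContMDiff (𝓡 (m + d)) (𝓡 n).tangent ∞ (fun x => (⟨f x, V x⟩ : TangentBundle (𝓡 n) N)) →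
      0 ≤ indexForm S h f V

end SubRiemannian

/-! ### The unit sphere -/

/-- The unit sphere `Sⁿ` in `ℝⁿ⁺¹`. -/
abbrev Sph (n : ℕ) : Type := Metric.sphere (0 : Euc (n + 1)) 1

/-- The differential of the inclusion of the sphere. -/
def sphIncl (n : ℕ) (p : Sph n) : TangentSpace (𝓡 n) p →L[ℝ] Euc (n + 1) :=
  mfderiv (𝓡 n) 𝓘(ℝ, Euc (n + 1)) (fun q : Sph n => (q : Euc (n + 1))) p

/-- The inner product on the tangent space of the sphere induced from `ℝⁿ⁺¹`. -/
def sphInner (n : ℕ) (p : Sph n) :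
    TangentSpace (𝓡 n) p →L[ℝ] TangentSpace (𝓡 n) p →L[ℝ] ℝ :=
  (ContinuousLinearMap.bilinearComp (innerSL ℝ (E := Euc (n + 1)))
    (sphIncl n p) (sphIncl n p) : Euc n →L[ℝ] Euc n →L[ℝ] ℝ)

theorem sphInner_apply (n : ℕ) (p : Sph n) (u v : TangentSpace (𝓡 n) p) :
    sphInner n p u v = inner ℝ (sphIncl n p u) (sphIncl n p v) := rfl

theorem sphIncl_injective (n : ℕ) (p : Sph n) : Function.Injective (sphIncl n p) :=
  haveI : Fact (Module.finrank ℝ (Euc (n + 1)) = n + 1) := ⟨finrank_euclideanSpace_fin⟩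
  injective_mvfderiv_subtypeVal_sphere (E := Euc (n + 1)) p

/-- The standard metric of the unit sphere, induced from `ℝⁿ⁺¹`. -/
def roundMetric (n : ℕ) : RMetric n (Sph n) where
  inner := sphInner n
  symm p v w := by
    rw [sphInner_apply, sphInner_apply]
    exact real_inner_comm _ _
  pos p v hv := by
    rw [sphInner_apply]
    refine real_inner_self_pos.2 fun h0 => hv ?_
    exact sphIncl_injective n p (h0.trans (map_zero (sphIncl n p)).symm)
  isVonNBounded p := by
    let L : Euc n →L[ℝ] Euc (n + 1) := sphIncl n p
    have hL : Function.Injective L.toLinearMap := sphIncl_injective n p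
    obtain ⟨K, hK, hanti⟩ := L.toLinearMap.exists_antilipschitzWith
      (LinearMap.ker_eq_bot.2 hL)
    have hb : Bornology.IsBounded {v : Euc n | sphInner n p v v < 1} := by
      refine (Metric.isBounded_ball (x := (0 : Euc n)) (r := K)).subset fun v hv => ?_
      have h1 : ‖L v‖ ^ 2 < 1 := by
        rw [← real_inner_self_eq_norm_sq]
        exact hv
      have h2 : ‖L v‖ < 1 := by
        nlinarith [norm_nonneg (L v)]
      have h3 := hanti.le_mul_dist v 0
      rw [map_zero, dist_zero_right, dist_zero_right] at h3
      rw [mem_ball_zero_iff]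
      refine h3.trans_lt ?_
      calc (K : ℝ) * ‖L v‖ < K * 1 := by
            exact mul_lt_mul_of_pos_left h2 (by exact_mod_cast hK)
        _ = K := mul_one _
    exact (NormedSpace.isVonNBounded_iff ℝ).2 hb
  contMDiff := by
    intro p
    have hfact : Fact (Module.finrank ℝ (Euc (n + 1)) = n + 1) := ⟨finrank_euclideanSpace_fin⟩
    have h0 : ContMDiffAt (𝓡 n) 𝓘(ℝ, Euc n →L[ℝ] Euc (n + 1)) ∞
        (inTangentCoordinates (𝓡 n) 𝓘(ℝ, Euc (n + 1)) id
          (fun q : Sph n => (q : Euc (n + 1))) (sphIncl n) p) p :=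
      ContMDiffAt.mfderiv_const (n := ω)
        (contMDiff_coe_sphere (E := Euc (n + 1))).contMDiffAt (by simp)
    have h1 : ContDiff ℝ ∞ (fun L : Euc n →L[ℝ] Euc (n + 1) =>
        (innerSL ℝ (E := Euc (n + 1))).bilinearComp L L) := by
      have e : ∀ L : Euc n →L[ℝ] Euc (n + 1), (innerSL ℝ (E := Euc (n + 1))).bilinearComp L L
          = (ContinuousLinearMap.compL ℝ (Euc n) (Euc (n + 1)) ℝ).flip L ∘L
            (innerSL ℝ (E := Euc (n + 1))) ∘L L := fun L => rfl
      simp_rw [e]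
      fun_prop
    rw [Bundle.contMDiffAt_section]
    refine (h1.contDiffAt.contMDiffAt.comp p h0).congr_of_eventuallyEq ?_
    have hbase : ∀ᶠ q in nhds p,
        q ∈ (trivializationAt (Euc n) (TangentSpace (𝓡 n) : Sph n → Type) p).baseSet :=
      (trivializationAt (Euc n) (TangentSpace (𝓡 n) : Sph n → Type) p).open_baseSet.mem_nhds
        (FiberBundle.mem_baseSet_trivializationAt' p)
    filter_upwards [hbase] with q hq
    ext v w
    simp [hom_trivializationAt_apply, ContinuousLinearMap.inCoordinates, inTangentCoordinates]
    have hmem : q ∈ (trivializationAt (Euc n →L[ℝ] ℝ)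
        (fun x : Sph n => TangentSpace (𝓡 n) x →L[ℝ] ℝ) p).baseSet := ⟨hq, Set.mem_univ q⟩
    rw [Bundle.Trivialization.coe_linearMapAt_of_mem _ hmem]
    change ContinuousLinearMap.inCoordinates (Euc n) (fun x : Sph n => TangentSpace (𝓡 n) x) ℝ
      (Bundle.Trivial (Sph n) ℝ) p q p q (sphInner n q
        ((trivializationAt (Euc n) (TangentSpace (𝓡 n) : Sph n → Type) p).symmL ℝ q v)) w = _
    simp only [ContinuousLinearMap.inCoordinates, ContinuousLinearMap.comp_apply]
    rw [sphInner_apply]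
    exact DFunLike.congr_fun
      (Bundle.Trivial.continuousLinearMapAt_trivialization ℝ (Sph n) ℝ q) _

end ExpSubelliptic

end

noncomputable section

namespace ExpSubelliptic

open scoped RealInnerProductSpace

/-! ### The round sphere in stereographic coordinates -/

/-! The index form is tested on the tangential projections along `f` of constant vectors of ℝⁿ⁺¹ and
summed over an orthonormal basis. Let `E` be a unit vector, `V = Eᵀ ∘ f`, `c = ⟪E, f⟫` and `N =
|df_H|²`. On the sphere `∇_X Eᵀ = -⟪E, p⟫ X` (`pullbackCov_sphProj`) and `R(X, Y)Z = ⟪Y, Z⟫X - ⟪X,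
Z⟫Y` (`sphIncl_curvature`). Hence the integrand of `I_H(V, V)` is `exp(N/2)` times `c²N² + 2c²N - N
+ ∑ᵢ ⟪E, df(eᵢ)⟫²` (`indexForm_sphProj`). Over an orthonormal basis the `c²` add up to 1 and the
last terms to `N`, so the total is `N² + 2N - (n+1)N + N = N(N - (n-2))` (`sum_sphIndexDensity`). If
the integral of this is negative, one of the `n+1` index forms is negative.

The connection and the curvature are given by Christoffel symbols in the chart at each point. On the
sphere this chart is stereographic projection from the antipode, the metric is conformally flat, and
the Christoffel symbols vanish at the centre; everything is evaluated there.

Splitting the integral of the sum needs integrability: the volume is finite and the densities are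
continuous, although the horizontal frame is chosen pointwise (`continuous_sum_sq_mfderiv_frame`).
-/

instance fact_finrank_euc (n : ℕ) : Fact (Module.finrank ℝ (Euc (n + 1)) = n + 1) :=
  ⟨finrank_euclideanSpace_fin⟩

section Stereographic

variable {n : ℕ}

/-- The inverse of the stereographic projection from `-p`, the tangent space at `p` being
parametrized by `J`. -/
def stereoInv (J : Euc n →ₗᵢ[ℝ] Euc (n + 1)) (p : Euc (n + 1)) (y : Euc n) : Euc (n + 1) :=
  (‖y‖ ^ 2 + 4)⁻¹ • ((4 : ℝ) • J y + (4 - ‖y‖ ^ 2) • p)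

/-- The differential of `stereoInv`. -/
def stereoInvDeriv (J : Euc n →ₗᵢ[ℝ] Euc (n + 1)) (p : Euc (n + 1)) (y : Euc n) :
    Euc n →L[ℝ] Euc (n + 1) :=
  (4 * (‖y‖ ^ 2 + 4)⁻¹) • J.toContinuousLinearMap
    - (8 * ((‖y‖ ^ 2 + 4)⁻¹) ^ 2) • (innerSL ℝ y).smulRight (J y + (2 : ℝ) • p)

theorem stereoInvDeriv_apply (J : Euc n →ₗᵢ[ℝ] Euc (n + 1)) (p : Euc (n + 1)) (y a : Euc n) :
    stereoInvDeriv J p y a = (4 * (‖y‖ ^ 2 + 4)⁻¹) • J a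
      - (8 * ((‖y‖ ^ 2 + 4)⁻¹) ^ 2 * ⟪y, a⟫) • (J y + (2 : ℝ) • p) := by
  simp [stereoInvDeriv, mul_smul]

theorem hasFDerivAt_normSq_add_four (y : Euc n) :
    HasFDerivAt (fun z : Euc n => ‖z‖ ^ 2 + 4) ((2 : ℝ) • innerSL ℝ y) y := by
  have := (hasStrictFDerivAt_norm_sq y).hasFDerivAt.add_const (4 : ℝ)
  simpa [ofNat_smul_eq_nsmul] using this

theorem hasFDerivAt_stereoInv (J : Euc n →ₗᵢ[ℝ] Euc (n + 1)) (p : Euc (n + 1)) (y : Euc n) :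
    HasFDerivAt (stereoInv J p) (stereoInvDeriv J p y) y := by
  have hs : ‖y‖ ^ 2 + 4 ≠ 0 := by positivity
  have h1 := (hasDerivAt_inv hs).comp_hasFDerivAt y (hasFDerivAt_normSq_add_four y)
  have h2 : HasFDerivAt (fun z : Euc n => 4 - ‖z‖ ^ 2) (-((2 : ℝ) • innerSL ℝ y)) y := by
    -- `4 - ‖z‖² = 8 - (‖z‖² + 4)`, so the derivative of the denominator can be reused.
    have := (hasFDerivAt_normSq_add_four y).const_sub (8 : ℝ)
    refine this.congr_of_eventuallyEq (Filter.Eventually.of_forall fun z => ?_)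
    ring
  have h3 := h1.smul (((J.toContinuousLinearMap.hasFDerivAt (x := y)).const_smul (4 : ℝ)).add
    (h2.smul_const p))
  refine HasFDerivAt.congr_fderiv h3 ?_
  ext1 a
  rw [stereoInvDeriv_apply]
  simp
  match_scalars <;> field_simp <;> ring

/-- Conformality of stereographic projection: since `‖J y + 2p‖² = ‖y‖² + 4`, the square of the
rank-one correction cancels the two cross terms. -/
theorem inner_stereoInvDeriv (J : Euc n →ₗᵢ[ℝ] Euc (n + 1)) {p : Euc (n + 1)} (hp : ‖p‖ = 1)
    (hJ : ∀ a, ⟪J a, p⟫ = 0) (y a b : Euc n) :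
    ⟪stereoInvDeriv J p y a, stereoInvDeriv J p y b⟫ = 16 / (‖y‖ ^ 2 + 4) ^ 2 * ⟪a, b⟫ := by
  have hs : ‖y‖ ^ 2 + 4 ≠ 0 := by positivity
  have hJ' : ∀ a, ⟪p, J a⟫ = 0 := fun a => by rw [real_inner_comm]; exact hJ a
  have hpp : ⟪p, p⟫ = 1 := by rw [real_inner_self_eq_norm_sq, hp]; norm_num
  simp only [stereoInvDeriv_apply, inner_sub_left, inner_sub_right, inner_add_left,
    inner_add_right, real_inner_smul_left, real_inner_smul_right, hJ, hJ', hpp,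
    LinearIsometry.inner_map_map, real_inner_self_eq_norm_sq, real_inner_comm y a]
  field_simp
  ring

theorem inner_stereoInv_stereoInvDeriv (J : Euc n →ₗᵢ[ℝ] Euc (n + 1)) {p : Euc (n + 1)}
    (hp : ‖p‖ = 1) (hJ : ∀ a, ⟪J a, p⟫ = 0) (y a : Euc n) :
    ⟪stereoInv J p y, stereoInvDeriv J p y a⟫ = 0 := by
  have hs : ‖y‖ ^ 2 + 4 ≠ 0 := by positivity
  have hJ' : ∀ a, ⟪p, J a⟫ = 0 := fun a => by rw [real_inner_comm]; exact hJ a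
  have hpp : ⟪p, p⟫ = 1 := by rw [real_inner_self_eq_norm_sq, hp]; norm_num
  simp only [stereoInvDeriv_apply, stereoInv, inner_sub_right, inner_add_left,
    inner_add_right, real_inner_smul_left, real_inner_smul_right, hJ, hJ', hpp,
    LinearIsometry.inner_map_map, real_inner_self_eq_norm_sq]
  field_simp
  ring

theorem stereoInvDeriv_zero (J : Euc n →ₗᵢ[ℝ] Euc (n + 1)) (p : Euc (n + 1)) (a : Euc n) :
    stereoInvDeriv J p 0 a = J a := by
  simp [stereoInvDeriv_apply]

theorem extChartAt_sphere_target (p : Sph n) : (extChartAt (𝓡 n) p).target = Set.univ := by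
  have h : (chartAt (Euc n) p).target = Set.univ := stereographic'_target (n := n) (-p)
  simp [extChartAt, h]

theorem extChartAt_sphere_self (p : Sph n) : extChartAt (𝓡 n) p p = 0 := by
  have h : chartAt (Euc n) p p = 0 := by
    change stereographic' n (-p) p = 0
    change (OrthonormalBasis.fromOrthogonalSpanSingleton n
      (ne_zero_of_mem_unit_sphere (-p))).repr (stereographic (norm_eq_of_mem_sphere (-p)) p) = 0
    rw [stereographic_neg_apply, map_zero]
  simpa [extChartAt] using h

/-- The chart depends on an unspecified orthonormal basis of `p`'s orthogonal complement. Only the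
resulting isometry onto that complement matters below, so nothing else about it is retained. -/
theorem exists_stereoInv_eq_extChartAt_symm (p : Sph n) :
    ∃ J : Euc n →ₗᵢ[ℝ] Euc (n + 1), (∀ a, ⟪J a, (p : Euc (n + 1))⟫ = 0) ∧
      (∀ z : Euc (n + 1), ⟪z, (p : Euc (n + 1))⟫ = 0 → ∃ a, J a = z) ∧
      ∀ y, (((extChartAt (𝓡 n) p).symm y : Sph n) : Euc (n + 1))
        = stereoInv J (p : Euc (n + 1)) y := by
  let U := (OrthonormalBasis.fromOrthogonalSpanSingleton (𝕜 := ℝ) n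
    (ne_zero_of_mem_unit_sphere (-p))).repr
  let J : Euc n →ₗᵢ[ℝ] Euc (n + 1) :=
    (Submodule.subtypeₗᵢ (ℝ ∙ ((-p : Sph n) : Euc (n + 1)))ᗮ).comp U.symm.toLinearIsometry
  have hJ : ∀ a, J a = (U.symm a : Euc (n + 1)) := fun _ => rfl
  refine ⟨J, fun a => ?_, fun z hz => ?_, fun y => ?_⟩
  · have h := Submodule.mem_orthogonal_singleton_iff_inner_left.mp (U.symm a).2
    rw [← hJ] at h
    simpa using h
  · have hz' : z ∈ (ℝ ∙ ((-p : Sph n) : Euc (n + 1)))ᗮ := by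
      rw [Submodule.mem_orthogonal_singleton_iff_inner_left]
      simpa using hz
    exact ⟨U ⟨z, hz'⟩, by rw [hJ, LinearIsometryEquiv.symm_apply_apply]⟩
  · have h := stereographic'_symm_apply (n := n) (-p) y
    change (((stereographic' n (-p)).symm y : Sph n) : Euc (n + 1)) = _
    rw [h]
    change (‖J y‖ ^ 2 + 4)⁻¹ • (4 : ℝ) • J y
      + (‖J y‖ ^ 2 + 4)⁻¹ • (‖J y‖ ^ 2 - 4) • (-(p : Euc (n + 1))) = _
    rw [LinearIsometry.norm_map, stereoInv]
    module

/-- The parametrization of the tangent space at `p` used by the chart at `p`. -/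
def sphTangent (p : Sph n) : Euc n →ₗᵢ[ℝ] Euc (n + 1) :=
  (exists_stereoInv_eq_extChartAt_symm p).choose

theorem inner_sphTangent (p : Sph n) (a : Euc n) : ⟪sphTangent p a, (p : Euc (n + 1))⟫ = 0 :=
  (exists_stereoInv_eq_extChartAt_symm p).choose_spec.1 a

theorem exists_sphTangent_eq (p : Sph n) {z : Euc (n + 1)} (hz : ⟪z, (p : Euc (n + 1))⟫ = 0) :
    ∃ a, sphTangent p a = z :=
  (exists_stereoInv_eq_extChartAt_symm p).choose_spec.2.1 z hz

theorem coe_extChartAt_symm_sphere (p : Sph n) (y : Euc n) :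
    (((extChartAt (𝓡 n) p).symm y : Sph n) : Euc (n + 1))
      = stereoInv (sphTangent p) (p : Euc (n + 1)) y :=
  (exists_stereoInv_eq_extChartAt_symm p).choose_spec.2.2 y

theorem mdifferentiableAt_extChartAt_symm_sphere (p : Sph n) (y : Euc n) :
    MDifferentiableAt (𝓡 n) (𝓡 n) (extChartAt (𝓡 n) p).symm y :=
  mdifferentiableOn_extChartAt_symm.mdifferentiableAt
    (by rw [extChartAt_sphere_target]; exact Filter.univ_mem)

/-- Chain rule for the inclusion composed with the inverse chart; it turns manifold derivatives into
the explicit formula. -/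
theorem sphIncl_dChartSymm (p : Sph n) (y a : Euc n) :
    sphIncl n ((extChartAt (𝓡 n) p).symm y) (dChartSymm p y a)
      = stereoInvDeriv (sphTangent p) (p : Euc (n + 1)) y a := by
  have h1 : HasMFDerivAt (𝓡 n) 𝓘(ℝ, Euc (n + 1)) (fun q : Sph n => (q : Euc (n + 1)))
      ((extChartAt (𝓡 n) p).symm y) (sphIncl n ((extChartAt (𝓡 n) p).symm y)) :=
    ((contMDiff_coe_sphere (E := Euc (n + 1)) (m := ∞)).mdifferentiableAt (by simp)).hasMFDerivAt
  have h2 := h1.comp y (mdifferentiableAt_extChartAt_symm_sphere p y).hasMFDerivAt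
  have h3 : (fun q : Sph n => (q : Euc (n + 1))) ∘ (extChartAt (𝓡 n) p).symm
      = stereoInv (sphTangent p) (p : Euc (n + 1)) :=
    funext (coe_extChartAt_symm_sphere p)
  rw [h3] at h2
  exact DFunLike.congr_fun (hasMFDerivAt_unique h2
    (hasFDerivAt_stereoInv (sphTangent p) (p : Euc (n + 1)) y).hasMFDerivAt) a

theorem dChartSymm_dChart (p : Sph n) (y : Euc n)
    (v : TangentSpace (𝓡 n) ((extChartAt (𝓡 n) p).symm y)) :
    dChartSymm p y (dChart p ((extChartAt (𝓡 n) p).symm y) v) = v := by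
  have h := mfderivWithin_extChartAt_symm_comp_mfderiv_extChartAt (I := 𝓡 n) (x := p) (y := y)
    (by rw [extChartAt_sphere_target]; trivial)
  rw [ModelWithCorners.range_eq_univ, mfderivWithin_univ] at h
  exact DFunLike.congr_fun h v

theorem stereoInvDeriv_dChart (p : Sph n) (y : Euc n)
    (v : TangentSpace (𝓡 n) ((extChartAt (𝓡 n) p).symm y)) :
    stereoInvDeriv (sphTangent p) (p : Euc (n + 1)) y
      (dChart p ((extChartAt (𝓡 n) p).symm y) v) = sphIncl n _ v := by
  rw [← sphIncl_dChartSymm, dChartSymm_dChart]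

theorem sphTangent_dChart_self (p : Sph n) (v : TangentSpace (𝓡 n) p) :
    sphTangent p (dChart p p v) = sphIncl n p v := by
  -- The tangent vector stays quantified during the rewriting, because its type depends on the base
  -- point.
  have h := stereoInvDeriv_dChart p (extChartAt (𝓡 n) p p)
  rw [extChartAt_to_inv] at h
  have h := h v
  rwa [extChartAt_sphere_self, stereoInvDeriv_zero] at h

theorem sphIncl_ofChart (p : Sph n) (a : Euc n) :
    sphIncl n p (ofChart p a) = sphTangent p a := by
  have h := sphIncl_dChartSymm p (extChartAt (𝓡 n) p p) a
  rw [extChartAt_to_inv] at h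
  have h' : dChartSymm p (extChartAt (𝓡 n) p p) a = ofChart p a := rfl
  rw [← stereoInvDeriv_zero _ (p : Euc (n + 1)), ← extChartAt_sphere_self p, ← h, ← h']

/-! ### Levi-Civita connection and curvature of the round metric -/

theorem chartMetric_roundMetric (p : Sph n) (y a b : Euc n) :
    chartMetric (roundMetric n) p y a b = 16 / (‖y‖ ^ 2 + 4) ^ 2 * ⟪a, b⟫ := by
  change sphInner n _ _ _ = _
  rw [sphInner_apply, sphIncl_dChartSymm, sphIncl_dChartSymm]
  exact inner_stereoInvDeriv _ (norm_eq_of_mem_sphere p) (inner_sphTangent p) y a b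

theorem gram_roundMetric (p : Sph n) (y : Euc n) :
    gram (roundMetric n) p y = (16 / (‖y‖ ^ 2 + 4) ^ 2) • (1 : Matrix (Fin n) (Fin n) ℝ) := by
  ext i j
  simp [gram, chartMetric_roundMetric, Matrix.one_apply, EuclideanSpace.inner_single_left,
    PiLp.single_apply]

theorem fderiv_chartMetric_roundMetric (p : Sph n) (y a b c : Euc n) :
    fderiv ℝ (fun z => chartMetric (roundMetric n) p z a b) y c
      = -64 / (‖y‖ ^ 2 + 4) ^ 3 * ⟪y, c⟫ * ⟪a, b⟫ := by
  have hs : ‖y‖ ^ 2 + 4 ≠ 0 := by positivity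
  simp_rw [chartMetric_roundMetric]
  have h1 : HasDerivAt (fun t : ℝ => 16 / t ^ 2 * ⟪a, b⟫)
      (-32 / (‖y‖ ^ 2 + 4) ^ 3 * ⟪a, b⟫) (‖y‖ ^ 2 + 4) := by
    have h0 : HasDerivAt (fun t : ℝ => t ^ 2) _ (‖y‖ ^ 2 + 4) := hasDerivAt_pow 2 (‖y‖ ^ 2 + 4)
    refine (((h0.fun_inv (pow_ne_zero 2 hs)).const_mul (16 : ℝ)).mul_const ⟪a, b⟫).congr_deriv ?_
    generalize ‖y‖ ^ 2 + 4 = s at hs ⊢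
    field_simp
    ring
  have h2 := HasDerivAt.comp_hasFDerivAt (h₂ := fun t : ℝ => 16 / t ^ 2 * ⟪a, b⟫) y h1
    (hasFDerivAt_normSq_add_four y)
  have h3 : HasFDerivAt (fun z : Euc n => 16 / (‖z‖ ^ 2 + 4) ^ 2 * ⟪a, b⟫) _ y := h2
  rw [h3.fderiv]
  simp
  ring

/-- For a conformal metric `e^{2u}δ` one has `Γ(a, b) = du(a) b + du(b) a - ⟪a, b⟫ ∇u`; here `u =
log (4 / (‖y‖² + 4))`. -/
theorem christoffel_roundMetric (p : Sph n) (y a b : Euc n) :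
    christoffel (roundMetric n) p y a b
      = (-2 / (‖y‖ ^ 2 + 4)) • (⟪y, a⟫ • b + ⟪y, b⟫ • a - ⟪a, b⟫ • y) := by
  have hs : ‖y‖ ^ 2 + 4 ≠ 0 := by positivity
  have hinv : (gram (roundMetric n) p y)⁻¹
      = ((‖y‖ ^ 2 + 4) ^ 2 / 16) • (1 : Matrix (Fin n) (Fin n) ℝ) := by
    rw [gram_roundMetric]
    refine Matrix.inv_eq_right_inv ?_
    rw [smul_mul_smul_comm, one_mul, div_mul_div_cancel₀' (by norm_num),
      div_self (pow_ne_zero 2 hs), one_smul]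
  ext r
  simp only [christoffel, hinv, fderiv_chartMetric_roundMetric]
  simp [Matrix.one_apply, EuclideanSpace.inner_single_right]
  field_simp
  ring

theorem christoffel_roundMetric_zero (p : Sph n) (a b : Euc n) :
    christoffel (roundMetric n) p 0 a b = 0 := by
  simp [christoffel_roundMetric]

/-- The bracket is linear in the base point and vanishes at 0, so only its derivative survives,
multiplied by the value `-2/4` of the scalar factor. -/
theorem fderiv_christoffel_roundMetric_zero (p : Sph n) (a b c : Euc n) :
    fderiv ℝ (fun z => christoffel (roundMetric n) p z a b) 0 c
      = (-1 / 2 : ℝ) • (⟪c, a⟫ • b + ⟪c, b⟫ • a - ⟪a, b⟫ • c) := by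
  simp_rw [christoffel_roundMetric]
  have hs : ‖(0 : Euc n)‖ ^ 2 + 4 ≠ 0 := by positivity
  have h1 := ((hasDerivAt_inv hs).comp_hasFDerivAt (0 : Euc n)
    (hasFDerivAt_normSq_add_four 0)).const_mul (-2 : ℝ)
  have h2 : ∀ a b : Euc n, HasFDerivAt (fun z : Euc n => ⟪z, a⟫ • b)
      ((innerSL ℝ a).smulRight b) 0 := fun a b => by
    have := ((innerSL ℝ a).smulRight b).hasFDerivAt (x := (0 : Euc n))
    refine this.congr_of_eventuallyEq (Filter.Eventually.of_forall fun z => ?_)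
    simp [real_inner_comm z a]
  have h3 := h1.smul (((h2 a b).add (h2 b a)).sub ((hasFDerivAt_id (0 : Euc n)).const_smul ⟪a, b⟫))
  have h4 : HasFDerivAt (fun z : Euc n => (-2 / (‖z‖ ^ 2 + 4)) •
      (⟪z, a⟫ • b + ⟪z, b⟫ • a - ⟪a, b⟫ • z)) _ 0 := h3
  rw [h4.fderiv]
  simp [real_inner_comm c]
  norm_num

/-- At the centre the quadratic terms in `Γ` vanish, and the antisymmetrized first derivatives give
constant curvature 1. -/
theorem chartCurvature_roundMetric (p : Sph n) (a b c : Euc n) :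
    chartCurvature (roundMetric n) p 0 a b c = ⟪b, c⟫ • a - ⟪a, c⟫ • b := by
  simp only [chartCurvature, christoffel_roundMetric_zero, fderiv_christoffel_roundMetric_zero,
    real_inner_comm a b]
  module

theorem inner_dChart_self (p : Sph n) (u v : TangentSpace (𝓡 n) p) :
    ⟪dChart p p u, dChart p p v⟫ = sphInner n p u v := by
  rw [sphInner_apply, ← sphTangent_dChart_self, ← sphTangent_dChart_self,
    LinearIsometry.inner_map_map]

theorem sphIncl_curvature (p : Sph n) (u v w : TangentSpace (𝓡 n) p) :
    sphIncl n p (curvature (roundMetric n) p u v w)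
      = sphInner n p v w • sphIncl n p u - sphInner n p u w • sphIncl n p v := by
  rw [curvature, sphIncl_ofChart, extChartAt_sphere_self, chartCurvature_roundMetric]
  simp only [map_sub, map_smul, sphTangent_dChart_self, inner_dChart_self]

end Stereographic

/-! ### Projections of constant vector fields to the sphere -/

section ConstantFields

variable {n : ℕ}

theorem exists_sphIncl_eq (E : Euc (n + 1)) (q : Sph n) :
    ∃ v : TangentSpace (𝓡 n) q,
      sphIncl n q v = E - ⟪E, (q : Euc (n + 1))⟫ • (q : Euc (n + 1)) := by
  have hz : ⟪E - ⟪E, (q : Euc (n + 1))⟫ • (q : Euc (n + 1)), (q : Euc (n + 1))⟫ = 0 := by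
    rw [inner_sub_left, real_inner_smul_left, real_inner_self_eq_norm_sq, norm_eq_of_mem_sphere]
    ring
  obtain ⟨a, ha⟩ := exists_sphTangent_eq q hz
  exact ⟨ofChart q a, by rw [sphIncl_ofChart, ha]⟩

/-- The tangential projection of the constant vector `E` at the point `q` of the sphere. -/
def sphProj (E : Euc (n + 1)) (q : Sph n) : TangentSpace (𝓡 n) q :=
  (exists_sphIncl_eq E q).choose

theorem sphIncl_sphProj (E : Euc (n + 1)) (q : Sph n) :
    sphIncl n q (sphProj E q) = E - ⟪E, (q : Euc (n + 1))⟫ • (q : Euc (n + 1)) :=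
  (exists_sphIncl_eq E q).choose_spec

/-- The field `sphProj E` in the chart at `p`. -/
def sphProjCoord (E : Euc (n + 1)) (p : Sph n) (y : Euc n) : Euc n :=
  ((‖y‖ ^ 2 + 4) / 4) • ContinuousLinearMap.adjoint (sphTangent p).toContinuousLinearMap E
    - (⟪E, sphTangent p y + (2 : ℝ) • (p : Euc (n + 1))⟫ / 2) • y

/-- This pairing determines the coordinate field: the normal part of `E` is orthogonal to the image
of the differential, so the metric product with `b` must be `E` paired with the image of `b`. -/
theorem inner_sphProjCoord (E : Euc (n + 1)) (p : Sph n) (y b : Euc n) :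
    16 / (‖y‖ ^ 2 + 4) ^ 2 * ⟪sphProjCoord E p y, b⟫
      = ⟪E, stereoInvDeriv (sphTangent p) (p : Euc (n + 1)) y b⟫ := by
  have hs : ‖y‖ ^ 2 + 4 ≠ 0 := by positivity
  rw [stereoInvDeriv_apply, sphProjCoord, inner_sub_left, inner_sub_right, real_inner_smul_left,
    real_inner_smul_left, real_inner_smul_right, real_inner_smul_right,
    ContinuousLinearMap.adjoint_inner_left, LinearIsometry.coe_toContinuousLinearMap]
  field_simp
  ring

theorem dChart_sphProj (E : Euc (n + 1)) (p : Sph n) {q : Sph n}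
    (hq : q ∈ (extChartAt (𝓡 n) p).source) :
    dChart p q (sphProj E q) = sphProjCoord E p (extChartAt (𝓡 n) p q) := by
  set y := extChartAt (𝓡 n) p q with hy
  have hqy : (extChartAt (𝓡 n) p).symm y = q := (extChartAt (𝓡 n) p).left_inv hq
  have h := stereoInvDeriv_dChart p y
  rw [hqy] at h
  have h := h (sphProj E q)
  refine ext_inner_right ℝ fun b => ?_
  have hs : (16 / (‖y‖ ^ 2 + 4) ^ 2 : ℝ) ≠ 0 := by positivity
  refine mul_left_cancel₀ hs ?_
  have hι : stereoInv (sphTangent p) (p : Euc (n + 1)) y = (q : Euc (n + 1)) := by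
    rw [← coe_extChartAt_symm_sphere, hqy]
  rw [inner_sphProjCoord, ← inner_stereoInvDeriv (sphTangent p) (norm_eq_of_mem_sphere p)
    (inner_sphTangent p), h, sphIncl_sphProj, inner_sub_left, real_inner_smul_left, ← hι,
    inner_stereoInv_stereoInvDeriv _ (norm_eq_of_mem_sphere p) (inner_sphTangent p)]
  ring

theorem contDiff_sphProjCoord (E : Euc (n + 1)) (p : Sph n) :
    ContDiff ℝ ∞ (sphProjCoord E p) := by
  have h : ContDiff ℝ ∞ fun y : Euc n => sphTangent p y :=
    (sphTangent p).toContinuousLinearMap.contDiff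
  have h' : ContDiff ℝ ∞ fun y : Euc n => ‖y‖ ^ 2 := contDiff_norm_sq ℝ
  unfold sphProjCoord
  exact (((h'.add contDiff_const).div_const 4).smul contDiff_const).sub
    (((contDiff_const.inner ℝ (h.add contDiff_const)).div_const 2).smul contDiff_id)

/-- The coefficient `(‖y‖² + 4)/4` is stationary at 0, so the derivative comes only from the term in
`y`, whose coefficient there is `-⟪E, 2p⟫/2`. -/
theorem hasFDerivAt_sphProjCoord_zero (E : Euc (n + 1)) (p : Sph n) :
    HasFDerivAt (sphProjCoord E p)
      (-⟪E, (p : Euc (n + 1))⟫ • ContinuousLinearMap.id ℝ (Euc n)) 0 := by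
  have h1 : HasFDerivAt (fun y : Euc n => (‖y‖ ^ 2 + 4) / 4) (0 : Euc n →L[ℝ] ℝ) 0 := by
    have := (hasFDerivAt_normSq_add_four (0 : Euc n)).const_mul (4⁻¹ : ℝ)
    simp only [map_zero, smul_zero] at this
    refine this.congr_of_eventuallyEq (Filter.Eventually.of_forall fun z => ?_)
    ring
  have h2 : HasFDerivAt (fun y : Euc n => ⟪E, sphTangent p y + (2 : ℝ) • (p : Euc (n + 1))⟫ / 2)
      ((2⁻¹ : ℝ) • (innerSL ℝ E ∘L (sphTangent p).toContinuousLinearMap)) 0 := by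
    have := ((innerSL ℝ E ∘L (sphTangent p).toContinuousLinearMap).hasFDerivAt
      (x := (0 : Euc n))).add_const ⟪E, (2 : ℝ) • (p : Euc (n + 1))⟫ |>.const_mul (2⁻¹ : ℝ)
    refine this.congr_of_eventuallyEq (Filter.Eventually.of_forall fun z => ?_)
    simp [inner_add_right]
    ring
  have h3 := (h1.smul_const
    (ContinuousLinearMap.adjoint (sphTangent p).toContinuousLinearMap E)).sub
    (h2.smul (hasFDerivAt_id (0 : Euc n)))
  refine HasFDerivAt.congr_fderiv h3 ?_
  ext1 a
  simp [real_inner_smul_right]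

variable {k : ℕ} {M : Type*} [TopologicalSpace M] [ChartedSpace (Euc k) M]

theorem contMDiff_sphProj_comp [IsManifold (𝓡 k) ∞ M] (E : Euc (n + 1)) {f : M → Sph n}
    (hf : ContMDiff (𝓡 k) (𝓡 n) ∞ f) :
    ContMDiff (𝓡 k) (𝓡 n).tangent ∞
      (fun x => (⟨f x, sphProj E (f x)⟩ : TangentBundle (𝓡 n) (Sph n))) := by
  intro x
  rw [Bundle.contMDiffAt_totalSpace]
  refine ⟨hf x, ?_⟩
  have hs : ∀ᶠ z in nhds x, f z ∈ (extChartAt (𝓡 n) (f x)).source :=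
    hf.continuous.continuousAt.eventually_mem (extChartAt_source_mem_nhds (f x))
  have h : ContMDiffAt (𝓡 k) (𝓡 n) ∞
      (fun z => sphProjCoord E (f x) (extChartAt (𝓡 n) (f x) (f z))) x :=
    (contDiff_sphProjCoord E (f x)).contMDiff.contMDiffAt.comp x
      ((contMDiffAt_extChartAt (x := f x)).comp x (hf x))
  refine h.congr_of_eventuallyEq ?_
  filter_upwards [hs] with z hz
  rw [← dChart_sphProj E (f x) hz]
  have hz' : f z ∈ (chartAt (Euc n) (f x)).source := by rwa [extChartAt_source] at hz
  -- The trivialization of the tangent bundle at `f x` is the differential of the chart there, so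
  -- the fibre component is `sphProjCoord`.
  have h1 := TangentBundle.continuousLinearMapAt_trivializationAt (I := 𝓡 n) hz'
  have h2 := DFunLike.congr_fun h1 (sphProj E (f z))
  refine Eq.trans ?_ h2
  rw [Bundle.Trivialization.continuousLinearMapAt_apply,
    Bundle.Trivialization.coe_linearMapAt_of_mem]
  simpa using hz'

end ConstantFields

/-! ### Covariant derivatives of the projected fields along a map -/

section Pullback

variable {n m d : ℕ} {M : Type*} [TopologicalSpace M] [ChartedSpace (Euc (m + d)) M]

theorem dCoord_sphProj (E : Euc (n + 1)) {f : M → Sph n}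
    (hf : ContMDiff (𝓡 (m + d)) (𝓡 n) ∞ f) (x : M) (u : TangentSpace (𝓡 (m + d)) x) :
    dCoord f (fun z => sphProj E (f z)) x u
      = -⟪E, (f x : Euc (n + 1))⟫ • dChart (f x) (f x) (mfderiv (𝓡 (m + d)) (𝓡 n) f x u) := by
  have hs : ∀ᶠ z in nhds x, f z ∈ (extChartAt (𝓡 n) (f x)).source :=
    hf.continuous.continuousAt.eventually_mem (extChartAt_source_mem_nhds (f x))
  have h1 : HasMFDerivAt (𝓡 (m + d)) (𝓡 n) f x _ :=
    (hf.mdifferentiableAt (by simp)).hasMFDerivAt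
  have h2 : HasMFDerivAt (𝓡 n) (𝓡 n) (extChartAt (𝓡 n) (f x)) (f x) _ :=
    (mdifferentiableAt_extChartAt (mem_chart_source _ (f x))).hasMFDerivAt
  have h3 : HasMFDerivAt (𝓡 n) (𝓡 n) (sphProjCoord E (f x)) (extChartAt (𝓡 n) (f x) (f x))
      (-⟪E, (f x : Euc (n + 1))⟫ • ContinuousLinearMap.id ℝ (Euc n)) := by
    rw [extChartAt_sphere_self]
    exact (hasFDerivAt_sphProjCoord_zero E (f x)).hasMFDerivAt
  have h4 := (HasMFDerivAt.comp x h3 (h2.comp x h1)).congr_of_eventuallyEq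
    (f₁ := fun z : M => dChart (f x) (f z) (sphProj E (f z)))
    (by filter_upwards [hs] with z hz using dChart_sphProj E (f x) hz)
  rw [dCoord, h4.mfderiv]
  rfl

theorem pullbackCov_sphProj (E : Euc (n + 1)) {f : M → Sph n}
    (hf : ContMDiff (𝓡 (m + d)) (𝓡 n) ∞ f) (x : M) (u : TangentSpace (𝓡 (m + d)) x) :
    pullbackCov (roundMetric n) f (fun z => sphProj E (f z)) x u
      = -⟪E, (f x : Euc (n + 1))⟫ • mfderiv (𝓡 (m + d)) (𝓡 n) f x u := by
  refine sphIncl_injective n (f x) ?_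
  rw [pullbackCov, dCoord_sphProj E hf, extChartAt_sphere_self, christoffel_roundMetric_zero,
    add_zero, sphIncl_ofChart, map_smul, map_smul, sphTangent_dChart_self]

end Pullback

/-! ### Continuity of metric expressions -/

section Continuity

variable {k : ℕ} {X : Type*} [TopologicalSpace X] [ChartedSpace (Euc k) X]
  [IsManifold (𝓡 k) ∞ X]

theorem continuousWithinAt_metric_inner (g : RMetric k X) {Y : Type*} [TopologicalSpace Y]
    {b : Y → X} {v w : ∀ y, TangentSpace (𝓡 k) (b y)} {s : Set Y} {y : Y}
    (hv : ContinuousWithinAt (fun y => (⟨b y, v y⟩ : TangentBundle (𝓡 k) X)) s y)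
    (hw : ContinuousWithinAt (fun y => (⟨b y, w y⟩ : TangentBundle (𝓡 k) X)) s y) :
    ContinuousWithinAt (fun y => g.inner (b y) (v y) (w y)) s y := by
  have hb : ContinuousWithinAt b s y :=
    (FiberBundle.continuous_proj (Euc k) (TangentSpace (𝓡 k) : X → Type)).continuousAt
      |>.comp_continuousWithinAt hv
  have h : ContinuousWithinAt (fun y => Bundle.TotalSpace.mk' ℝ (E := Bundle.Trivial X ℝ) (b y)
      (g.inner (b y) (v y) (w y))) s y :=
    ContinuousWithinAt.clm_bundle_apply₂ (F₁ := Euc k) (F₂ := Euc k)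
      (g.contMDiff.continuous.continuousAt.comp_continuousWithinAt hb) hv hw
  rw [FiberBundle.continuousWithinAt_totalSpace] at h
  exact h.2

theorem continuousOn_chartMetric (g : RMetric k X) (p : X) (a b : Euc k) :
    ContinuousOn (fun y => chartMetric g p y a b) (extChartAt (𝓡 k) p).target := by
  have ht : IsOpen (extChartAt (𝓡 k) p).target := isOpen_extChartAt_target p
  have h : ∀ a : Euc k, ContinuousOn
      (fun y => (⟨(extChartAt (𝓡 k) p).symm y, dChartSymm p y a⟩ : TangentBundle (𝓡 k) X))
      (extChartAt (𝓡 k) p).target := fun a => by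
    have h1 := (contMDiffOn_extChartAt_symm (I := 𝓡 k) (n := ∞) p).continuousOn_tangentMapWithin
      (by simp) ht.uniqueMDiffOn
    have h2 : Continuous fun y : Euc k => (⟨y, a⟩ : TangentBundle (𝓡 k) (Euc k)) :=
      (tangentBundleModelSpaceHomeomorph (𝓡 k)).symm.continuous.comp
        (continuous_id.prodMk continuous_const)
    refine (h1.comp h2.continuousOn fun y hy => hy).congr fun y hy => ?_
    simp only [Function.comp_apply, tangentMapWithin, mfderivWithin_of_isOpen ht hy]
    rfl
  exact fun y hy => continuousWithinAt_metric_inner g (h a y hy) (h b y hy)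

theorem continuousOn_sqrt_det_gram (g : RMetric k X) (p : X) :
    ContinuousOn (fun y => √(gram g p y).det) (extChartAt (𝓡 k) p).target := by
  refine Real.continuous_sqrt.comp_continuousOn ?_
  have h : ContinuousOn (fun y => gram g p y) (extChartAt (𝓡 k) p).target :=
    continuousOn_pi.2 fun i => continuousOn_pi.2 fun j =>
      continuousOn_chartMetric g p (stdVec i) (stdVec j)
  exact (Continuous.matrix_det continuous_id).comp_continuousOn h

/-- By compactness only finitely many partition functions are nonzero, and each contributes at most
the integral of the continuous density `√(det g)` over the compact chart image of its support. -/
theorem isFiniteMeasure_riemannianVolume [T2Space X] [CompactSpace X] [MeasurableSpace X]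
    [BorelSpace X] (g : RMetric k X) : IsFiniteMeasure (riemannianVolume g) := by
  refine ⟨?_⟩
  set ρ := chartPartition k X with hρ
  have hsub : ∀ i, tsupport (ρ i) ⊆ (chartAt (Euc k) i).source :=
    (SmoothPartitionOfUnity.exists_isSubordinate_chartAt_source (𝓡 k) X).choose_spec
  have hfin : {i | (Function.support (ρ i)).Nonempty}.Finite :=
    ρ.locallyFinite.finite_nonempty_of_compact
  rw [riemannianVolume, Measure.sum_apply _ MeasurableSet.univ]
  rw [tsum_eq_sum (s := hfin.toFinset) (fun i hi => ?_)]
  · refine ENNReal.sum_lt_top.2 fun i _ => ?_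
    set K := tsupport (ρ i)
    have hK : IsCompact K := (isClosed_tsupport _).isCompact
    set C := extChartAt (𝓡 k) i '' K
    have hKs : K ⊆ (extChartAt (𝓡 k) i).source := by
      rw [extChartAt_source]
      exact hsub i
    have hC : IsCompact C := hK.image_of_continuousOn ((continuousOn_extChartAt i).mono hKs)
    have hCt : C ⊆ (extChartAt (𝓡 k) i).target :=
      (Set.image_mono hKs).trans (extChartAt (𝓡 k) i).image_source_eq_target.subset
    set ν := (volume.restrict (extChartAt (𝓡 k) i).target).withDensity
      fun y => ENNReal.ofReal (√(gram g i y).det)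
    have hν : ν C < ⊤ := by
      have hb := (((continuousOn_sqrt_det_gram g i).mono hCt).integrableOn_compact
        (μ := volume) hC).lintegral_lt_top
      rw [withDensity_apply _ hC.measurableSet]
      exact (lintegral_mono' (Measure.restrict_mono_measure Measure.restrict_le_self _)
        le_rfl).trans_lt hb
    rw [withDensity_apply _ MeasurableSet.univ, Measure.restrict_univ]
    -- An upper bound suffices, and it requires no measurability of the inverse chart.
    calc ∫⁻ x, ENNReal.ofReal (ρ i x) ∂(ν.map (extChartAt (𝓡 k) i).symm)
        ≤ ∫⁻ y, ENNReal.ofReal (ρ i ((extChartAt (𝓡 k) i).symm y)) ∂ν := lintegral_map_le _ _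
      _ ≤ ∫⁻ y, C.indicator 1 y ∂ν := by
          refine lintegral_mono_ae ?_
          have hae : ∀ᵐ y ∂ν, y ∈ (extChartAt (𝓡 k) i).target :=
            (withDensity_absolutelyContinuous _ _).ae_le
              (ae_restrict_mem (isOpen_extChartAt_target i).measurableSet)
          filter_upwards [hae] with y hy
          by_cases h : y ∈ C
          · rw [Set.indicator_of_mem h]
            simpa using ρ.le_one i _
          · have h0 : ρ i ((extChartAt (𝓡 k) i).symm y) = 0 := by
              by_contra h0
              exact h ⟨_, subset_tsupport _ h0, (extChartAt (𝓡 k) i).right_inv hy⟩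
            rw [h0, ENNReal.ofReal_zero]
            exact zero_le
      _ = ν C := lintegral_indicator_one hC.measurableSet
      _ < ⊤ := hν
  · have h0 : ∀ x, ρ i x = 0 := fun x => by
      by_contra h0
      exact hi (hfin.mem_toFinset.2 ⟨x, h0⟩)
    change (Measure.withDensity _ fun x => ENNReal.ofReal (ρ i x)) Set.univ = 0
    simp only [h0, ENNReal.ofReal_zero]
    simp

end Continuity

/-! ### Traces over the horizontal distribution -/

section Traces

open Matrix in
/-- The sum of the squares of a linear form over an orthonormal family, in terms of the Gram
matrix of a family spanning the same space. -/
theorem gram_inv_of_orthonormal {m : ℕ} {T : Type*} [AddCommGroup T] [Module ℝ T]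
    (B : T →ₗ[ℝ] T →ₗ[ℝ] ℝ) (e s : Fin m → T)
    (he : ∀ i j, B (e i) (e j) = if i = j then 1 else 0)
    (hes : ∀ i, e i ∈ Submodule.span ℝ (Set.range s)) :
    (Matrix.of fun i j => B (s i) (s j)).det ≠ 0 ∧
      ∀ φ : T →ₗ[ℝ] ℝ, ∑ i, φ (e i) ^ 2 =
        (fun i => φ (s i)) ⬝ᵥ ((Matrix.of fun i j => B (s i) (s j))⁻¹ *ᵥ fun i => φ (s i)) := by
  choose Q hQ using fun i => Submodule.mem_span_range_iff_exists_fun ℝ |>.1 (hes i)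
  set G := Matrix.of fun i j => B (s i) (s j) with hG
  set P : Matrix (Fin m) (Fin m) ℝ := Matrix.of Q with hP
  -- With `e = P s`, orthonormality reads `P G Pᵀ = 1`, so `G` is invertible with inverse `Pᵀ P`.
  have h1 : P * (G * Pᵀ) = 1 := by
    ext i j
    rw [Matrix.one_apply, ← he, ← hQ i, ← hQ j]
    simp only [map_sum, map_smul, LinearMap.sum_apply, LinearMap.smul_apply, smul_eq_mul,
      Matrix.mul_apply, Matrix.transpose_apply, Matrix.of_apply, Finset.mul_sum, hP, hG]
    rw [Finset.sum_comm]
    exact Finset.sum_congr rfl fun _ _ => Finset.sum_congr rfl fun _ _ => by ring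
  have h2 : G * (Pᵀ * P) = 1 := by
    rw [← Matrix.mul_assoc]
    exact mul_eq_one_comm.1 h1
  refine ⟨fun h0 => ?_, fun φ => ?_⟩
  · have := congrArg Matrix.det h2
    simp [Matrix.det_mul, h0] at this
  · have h3 : (fun i => φ (e i)) = P *ᵥ fun i => φ (s i) := by
      ext i
      rw [← hQ i]
      simp [Matrix.mulVec, dotProduct, hP]
    rw [Matrix.inv_eq_right_inv h2, ← Matrix.mulVec_mulVec, ← h3, Matrix.dotProduct_mulVec,
      Matrix.vecMul_transpose, ← h3]
    simp [dotProduct, sq]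

variable {m d : ℕ} {M : Type*} [TopologicalSpace M] [ChartedSpace (Euc (m + d)) M]
  [IsManifold (𝓡 (m + d)) ∞ M]

theorem SubRiemannianStructure.frame_mem (S : SubRiemannianStructure m d M) (x : M) (i : Fin m) :
    S.frame x i ∈ S.H x :=
  (S.exists_orthonormal x).choose_spec.1 i

theorem SubRiemannianStructure.inner_frame (S : SubRiemannianStructure m d M) (x : M)
    (i j : Fin m) : S.g.inner x (S.frame x i) (S.frame x j) = if i = j then 1 else 0 :=
  (S.exists_orthonormal x).choose_spec.2 i j

/-- The differential of a real function. -/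
def realDiff (φ : M → ℝ) (x : M) : TangentSpace (𝓡 (m + d)) x →L[ℝ] ℝ :=
  mfderiv (𝓡 (m + d)) 𝓘(ℝ, ℝ) φ x

/-- The chosen orthonormal frame need not be continuous. The sum does not depend on that choice:
near each point it is a quadratic form in the derivatives along a smooth local frame, with the
inverse Gram matrix as coefficients. -/
theorem continuous_sum_sq_mfderiv_frame (S : SubRiemannianStructure m d M) {φ : M → ℝ}
    (hφ : ContMDiff (𝓡 (m + d)) 𝓘(ℝ, ℝ) ∞ φ) :
    Continuous fun x =>
      ∑ i, realDiff φ x (S.frame x i) ^ 2 := by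
  rw [continuous_iff_continuousAt]
  intro x₀
  obtain ⟨U, hU, hx₀, s, hs, hspan⟩ := S.exists_localFrame x₀
  have hUn : U ∈ nhds x₀ := hU.mem_nhds hx₀
  have hsc : ∀ i, ContinuousAt
      (fun x => (⟨x, s i x⟩ : TangentBundle (𝓡 (m + d)) M)) x₀ := fun i =>
    (hs i).continuousOn.continuousAt hUn
  have hb : ContinuousAt (fun x => fun i => realDiff φ x (s i x)) x₀ := by
    refine continuousAt_pi.2 fun i => ?_
    have h1 : Continuous (tangentMap (𝓡 (m + d)) 𝓘(ℝ, ℝ) φ) :=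
      hφ.continuous_tangentMap (by simp)
    have h2 : Continuous fun p : TangentBundle 𝓘(ℝ, ℝ) ℝ => p.2 :=
      (contMDiff_snd_tangentBundle_modelSpace (n := ∞) ℝ 𝓘(ℝ, ℝ)).continuous
    exact (h2.comp h1).continuousAt.comp (hsc i)
  have hG : ContinuousAt (fun x => Matrix.of fun i j => S.g.inner x (s i x) (s j x)) x₀ := by
    refine continuousAt_pi.2 fun i => continuousAt_pi.2 fun j => ?_
    rw [← continuousWithinAt_univ]
    exact continuousWithinAt_metric_inner S.g (hsc i).continuousWithinAt
      (hsc j).continuousWithinAt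
  let B : ∀ x : M, TangentSpace (𝓡 (m + d)) x →ₗ[ℝ] TangentSpace (𝓡 (m + d)) x →ₗ[ℝ] ℝ :=
    fun x => LinearMap.mk₂ ℝ (fun u v => S.g.inner x u v) (by simp) (by simp) (by simp) (by simp)
  have key := fun x (hx : x ∈ U) => gram_inv_of_orthonormal (B x) (S.frame x) (fun i => s i x)
    (S.inner_frame x) (fun i => (hspan x hx).2 ▸ S.frame_mem x i)
  have hGi : ContinuousAt
      (fun x => (Matrix.of fun i j => S.g.inner x (s i x) (s j x))⁻¹) x₀ := by
    refine ContinuousAt.comp (g := fun A : Matrix (Fin m) (Fin m) ℝ => A⁻¹)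
      (continuousAt_matrix_inv _ ?_) hG
    have := NormedRing.inverse_continuousAt (Units.mk0 _ (key x₀ hx₀).1)
    exact this
  have hcont : ContinuousAt (fun x =>
      dotProduct (fun i => realDiff φ x (s i x))
        (Matrix.mulVec (Matrix.of fun i j => S.g.inner x (s i x) (s j x))⁻¹
          fun i => realDiff φ x (s i x))) x₀ := by
    have hd : Continuous fun q : (Fin m → ℝ) × Matrix (Fin m) (Fin m) ℝ =>
        dotProduct q.1 (Matrix.mulVec q.2 q.1) := by fun_prop
    exact ContinuousAt.comp (g := fun q : (Fin m → ℝ) × Matrix (Fin m) (Fin m) ℝ =>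
        dotProduct q.1 (Matrix.mulVec q.2 q.1)) hd.continuousAt (hb.prodMk hGi)
  refine hcont.congr ?_
  filter_upwards [hUn] with x hx
  exact ((key x hx).2 (realDiff φ x).toLinearMap).symm

end Traces

/-! ### The index form on projections of constant vector fields -/

section IndexForm

variable {n m d : ℕ} {M : Type*} [TopologicalSpace M] [ChartedSpace (Euc (m + d)) M]

theorem inner_sphIncl_self (p : Sph n) (v : TangentSpace (𝓡 n) p) :
    ⟪(p : Euc (n + 1)), sphIncl n p v⟫ = 0 := by
  rw [← sphTangent_dChart_self, real_inner_comm, inner_sphTangent]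

theorem sphInner_comm (p : Sph n) (u v : TangentSpace (𝓡 n) p) :
    sphInner n p u v = sphInner n p v u :=
  (roundMetric n).symm p u v

theorem sphInner_sphProj_left (E : Euc (n + 1)) (p : Sph n) (v : TangentSpace (𝓡 n) p) :
    sphInner n p (sphProj E p) v = ⟪E, sphIncl n p v⟫ := by
  rw [sphInner_apply, sphIncl_sphProj, inner_sub_left, real_inner_smul_left, inner_sphIncl_self]
  ring

theorem sphInner_sphProj_self (E : Euc (n + 1)) (p : Sph n) :
    sphInner n p (sphProj E p) (sphProj E p) = ‖E‖ ^ 2 - ⟪E, (p : Euc (n + 1))⟫ ^ 2 := by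
  rw [sphInner_sphProj_left, sphIncl_sphProj, inner_sub_right, real_inner_smul_right,
    real_inner_self_eq_norm_sq]
  ring

theorem sphInner_curvature (p : Sph n) (u v w z : TangentSpace (𝓡 n) p) :
    sphInner n p (curvature (roundMetric n) p u v w) z
      = sphInner n p v w * sphInner n p u z - sphInner n p u w * sphInner n p v z := by
  rw [sphInner_apply, sphIncl_curvature, inner_sub_left, real_inner_smul_left,
    real_inner_smul_left, ← sphInner_apply, ← sphInner_apply]

theorem contMDiff_inner_sphere (E : Euc (n + 1)) {f : M → Sph n}
    (hf : ContMDiff (𝓡 (m + d)) (𝓡 n) ∞ f) :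
    ContMDiff (𝓡 (m + d)) 𝓘(ℝ, ℝ) ∞ fun x => ⟪E, (f x : Euc (n + 1))⟫ :=
  (innerSL ℝ E).contMDiff.comp ((contMDiff_coe_sphere (E := Euc (n + 1))).comp hf)

theorem realDiff_inner_sphere (E : Euc (n + 1)) {f : M → Sph n}
    (hf : ContMDiff (𝓡 (m + d)) (𝓡 n) ∞ f) (x : M) (u : TangentSpace (𝓡 (m + d)) x) :
    realDiff (fun x => ⟪E, (f x : Euc (n + 1))⟫) x u
      = ⟪E, sphIncl n (f x) (mfderiv (𝓡 (m + d)) (𝓡 n) f x u)⟫ := by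
  have h1 : HasMFDerivAt (𝓡 (m + d)) (𝓡 n) f x _ :=
    (hf.mdifferentiableAt (by simp)).hasMFDerivAt
  have h2 : HasMFDerivAt (𝓡 n) 𝓘(ℝ, Euc (n + 1)) (fun q : Sph n => (q : Euc (n + 1)))
      (f x) (sphIncl n (f x)) :=
    ((contMDiff_coe_sphere (E := Euc (n + 1)) (m := ∞)).mdifferentiableAt (by simp)).hasMFDerivAt
  have h3 : HasMFDerivAt 𝓘(ℝ, Euc (n + 1)) 𝓘(ℝ, ℝ) (innerSL ℝ E) (f x : Euc (n + 1))
      (innerSL ℝ E) := (innerSL ℝ E).hasMFDerivAt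
  have h4 : HasMFDerivAt (𝓡 (m + d)) 𝓘(ℝ, ℝ) (fun x => ⟪E, (f x : Euc (n + 1))⟫) x _ :=
    HasMFDerivAt.comp x h3 (h2.comp x h1)
  rw [realDiff, h4.mfderiv]
  rfl

variable [IsManifold (𝓡 (m + d)) ∞ M]

/-- The horizontal energy density of the component `⟪E, f⟫`. -/
def normSqHorizCoord (S : SubRiemannianStructure m d M) (f : M → Sph n) (E : Euc (n + 1))
    (x : M) : ℝ :=
  ∑ i, ⟪E, sphIncl n (f x) (mfderiv (𝓡 (m + d)) (𝓡 n) f x (S.frame x i))⟫ ^ 2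

theorem continuous_normSqHorizCoord (S : SubRiemannianStructure m d M) {f : M → Sph n}
    (hf : ContMDiff (𝓡 (m + d)) (𝓡 n) ∞ f) (E : Euc (n + 1)) :
    Continuous (normSqHorizCoord S f E) := by
  have h := continuous_sum_sq_mfderiv_frame S (contMDiff_inner_sphere E hf)
  simp only [realDiff_inner_sphere E hf] at h
  exact h

/-- Parseval in ℝⁿ⁺¹ for each `df(eᵢ)`. It serves both the final summation and the continuity of
`|df_H|²`, which reduces to that of real components. -/
theorem normSqHoriz_roundMetric (S : SubRiemannianStructure m d M) (f : M → Sph n) (x : M) :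
    normSqHoriz S (roundMetric n) f x = ∑ A, normSqHorizCoord S f (stdVec A) x := by
  unfold normSqHorizCoord
  rw [Finset.sum_comm]
  refine Finset.sum_congr rfl fun i _ => ?_
  change sphInner n _ _ _ = _
  rw [sphInner_apply, real_inner_self_eq_norm_sq, EuclideanSpace.real_norm_sq_eq]
  simp [EuclideanSpace.inner_single_left]

theorem continuous_normSqHoriz_roundMetric (S : SubRiemannianStructure m d M) {f : M → Sph n}
    (hf : ContMDiff (𝓡 (m + d)) (𝓡 n) ∞ f) :
    Continuous (normSqHoriz S (roundMetric n) f) := by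
  rw [funext (normSqHoriz_roundMetric S f)]
  exact continuous_finsetSum _ fun A _ => continuous_normSqHorizCoord S hf _

/-- The integrand of the index form on the projection of the constant unit field `E`. -/
def sphIndexDensity (S : SubRiemannianStructure m d M) (f : M → Sph n) (E : Euc (n + 1))
    (x : M) : ℝ :=
  Real.exp (normSqHoriz S (roundMetric n) f x / 2) *
    (⟪E, (f x : Euc (n + 1))⟫ ^ 2 * normSqHoriz S (roundMetric n) f x ^ 2
      + 2 * ⟪E, (f x : Euc (n + 1))⟫ ^ 2 * normSqHoriz S (roundMetric n) f x
      - normSqHoriz S (roundMetric n) f x + normSqHorizCoord S f E x)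

/-- Since the covariant derivative of the field is `-c df`, the first two terms are `c²N²` and
`c²N`. The curvature term is `(1 - c²)N` minus the energy density of `⟪E, f⟫`, as `‖Eᵀ‖² = 1 - c²`.
-/
theorem indexForm_sphProj [T2Space M] [SigmaCompactSpace M] [MeasurableSpace M]
    (S : SubRiemannianStructure m d M) {f : M → Sph n}
    (hf : ContMDiff (𝓡 (m + d)) (𝓡 n) ∞ f) {E : Euc (n + 1)} (hE : ‖E‖ = 1) :
    indexForm S (roundMetric n) f (fun x => sphProj E (f x))
      = ∫ x, sphIndexDensity S f E x ∂(riemannianVolume S.g) := by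
  refine integral_congr_ae (Filter.Eventually.of_forall fun x => ?_)
  simp only [pullbackCov_sphProj E hf]
  set c := ⟪E, (f x : Euc (n + 1))⟫ with hc
  set D : Fin m → TangentSpace (𝓡 n) (f x) :=
    fun i => mfderiv (𝓡 (m + d)) (𝓡 n) f x (S.frame x i) with hD
  set N := normSqHoriz S (roundMetric n) f x with hN
  have hN' : N = ∑ i, sphInner n (f x) (D i) (D i) := rfl
  have h1 : ∑ i, sphInner n (f x) (-c • D i) (D i) = -c * N := by
    rw [hN', Finset.mul_sum]
    exact Finset.sum_congr rfl fun i _ => by simp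
  have h2 : ∑ i, sphInner n (f x) (-c • D i) (-c • D i) = c ^ 2 * N := by
    rw [hN', Finset.mul_sum]
    exact Finset.sum_congr rfl fun i _ => by simp; ring
  have h3 : ∑ i, sphInner n (f x)
      (curvature (roundMetric n) (f x) (D i) (sphProj E (f x)) (sphProj E (f x))) (D i)
      = (1 - c ^ 2) * N - normSqHorizCoord S f E x := by
    rw [hN', Finset.mul_sum, normSqHorizCoord, ← Finset.sum_sub_distrib]
    refine Finset.sum_congr rfl fun i _ => ?_
    rw [sphInner_curvature, sphInner_sphProj_self, hE, sphInner_sphProj_left,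
      sphInner_comm _ (D i) (sphProj E (f x)), sphInner_sphProj_left]
    ring
  change Real.exp (N / 2) * ((∑ i, sphInner n (f x) (-c • D i) (D i)) ^ 2
    + ∑ i, sphInner n (f x) (-c • D i) (-c • D i) - ∑ i, sphInner n (f x)
      (curvature (roundMetric n) (f x) (D i) (sphProj E (f x)) (sphProj E (f x))) (D i)) = _
  rw [h1, h2, h3, sphIndexDensity, ← hc, ← hN]
  ring

theorem sum_sphIndexDensity (S : SubRiemannianStructure m d M) (f : M → Sph n) (x : M) :
    ∑ A, sphIndexDensity S f (stdVec A) x = Real.exp (normSqHoriz S (roundMetric n) f x / 2) *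
      (normSqHoriz S (roundMetric n) f x *
        (normSqHoriz S (roundMetric n) f x - ((n : ℝ) - 2))) := by
  have hc : ∑ A : Fin (n + 1), ⟪stdVec A, (f x : Euc (n + 1))⟫ ^ 2 = 1 := by
    have h := EuclideanSpace.real_norm_sq_eq (f x : Euc (n + 1))
    rw [norm_eq_of_mem_sphere] at h
    simpa [EuclideanSpace.inner_single_left] using h.symm
  unfold sphIndexDensity
  rw [← Finset.mul_sum, Finset.sum_add_distrib, Finset.sum_sub_distrib, Finset.sum_add_distrib,
    ← Finset.sum_mul, ← Finset.sum_mul, ← Finset.mul_sum, hc, ← normSqHoriz_roundMetric]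
  simp
  ring

theorem integrable_sphIndexDensity [T2Space M] [CompactSpace M] [MeasurableSpace M]
    [BorelSpace M] (S : SubRiemannianStructure m d M) {f : M → Sph n}
    (hf : ContMDiff (𝓡 (m + d)) (𝓡 n) ∞ f) (E : Euc (n + 1)) :
    Integrable (sphIndexDensity S f E) (riemannianVolume S.g) := by
  have := isFiniteMeasure_riemannianVolume S.g
  have hN := continuous_normSqHoriz_roundMetric S hf
  have hT := continuous_normSqHorizCoord S hf E
  have hc : Continuous fun x => ⟪E, (f x : Euc (n + 1))⟫ :=
    (contMDiff_inner_sphere E hf).continuous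
  have h : Continuous (sphIndexDensity S f E) := by
    unfold sphIndexDensity
    fun_prop
  exact h.integrable_of_hasCompactSupport (HasCompactSupport.of_compactSpace _)

end IndexForm

end ExpSubelliptic

end

/-! ### Averaging the index form over the standard basis -/

theorem mainTheorem4 (m d n : ℕ) {M : Type*} [TopologicalSpace M] [T2Space M] [CompactSpace M]
    [ConnectedSpace M] [ChartedSpace (ExpSubelliptic.Euc (m + d)) M]
    [IsManifold (𝓡 (m + d)) ∞ M] [MeasurableSpace M] [BorelSpace M]
    (S : ExpSubelliptic.SubRiemannianStructure m d M)
    (f : M → Metric.sphere (0 : EuclideanSpace ℝ (Fin (n + 1))) 1)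
    (hf : ExpSubelliptic.IsExpSubellipticHarmonic S (ExpSubelliptic.roundMetric n) f)
    (hconst : ¬ ∃ c, ∀ x, f x = c)
    (hneg : ∫ x, Real.exp (ExpSubelliptic.normSqHoriz S (ExpSubelliptic.roundMetric n) f x / 2) *
        (ExpSubelliptic.normSqHoriz S (ExpSubelliptic.roundMetric n) f x *
          (ExpSubelliptic.normSqHoriz S (ExpSubelliptic.roundMetric n) f x - ((n : ℝ) - 2)))
        ∂(ExpSubelliptic.riemannianVolume S.g) < 0) :
    ¬ ExpSubelliptic.IsStable S (ExpSubelliptic.roundMetric n) f := by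
  intro hstable
  refine hneg.not_ge ?_
  simp_rw [← ExpSubelliptic.sum_sphIndexDensity]
  -- The integral becomes the sum of the index forms of the `n+1` projected basis vectors, each
  -- nonnegative under stability.
  rw [integral_finsetSum _ fun A _ => ExpSubelliptic.integrable_sphIndexDensity S hf.1 _]
  refine Finset.sum_nonneg fun A _ => ?_
  rw [← ExpSubelliptic.indexForm_sphProj S hf.1 (by simp)]
  exact hstable _ (ExpSubelliptic.contMDiff_sphProj_comp _ hf.1)
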